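/- For a real number $q>0$ let $\mathcal G(q)=\{0,\,1,\,1+q,\,1+q+q^2,\,\dots\}\subset\mathbb R$ with the standard metric, and let $\mathbb R^n_\infty$ be $\mathbb R^n$ with the maximum metric $\|x-y\|_\infty=\max_i|x_i-y_i|$. A subset $C$ of a metric space is a copy of a metric space $\mathcal M$ if there is a bijective isometry $\mathcal M\to C$. A copy $C\subset\mathbb R^n_\infty$ of $\mathcal G(q)$ is called proper if for some $i\in\{1,\dots,n\}$ the set of $i$-th coordinates of the points of $C$ is a translate of $-\mathcal G(q)$. Let $\chi(\mathbb R^n_\infty,\mathcal M)$ denote the smallest $k$ such that $\mathbb R^n$ can be coloured with $k$ colours without a monochromatic copy of $\mathcal M$. (i) Let $n$ be a positive integer, $0<\varepsilon\le\frac12$ and $0<q\le\varepsilon/2^{n+1}$. Then every colouring of the cube $[-\varepsilon,1+\varepsilon]^n$ with $n$ colours contains a monochromatic proper copy of $\mathcal G(q)$ (with respect to the maximum metric). (ii) For every positive integer $n$ there exists $q_0>0$ such that $\chi(\mathbb R^n_\infty,\mathcal G(q))=n+1$ for all $0<q\le q_0$. -/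

import Mathlib

/-- The geometric progression `{0, 1, 1 + q, 1 + q + q², …} ⊆ ℝ` of partial sums; as a subtype of
`ℝ` it carries the standard metric. -/
def geomBaton (q : ℝ) : Set ℝ :=
  Set.range fun k : ℕ => ∑ i ∈ Finset.range k, q ^ i

/-- `C ⊆ X` is a copy of the metric space `Y`: there is a bijective isometry from `Y` onto `C`. -/
def IsCopy (Y : Type*) [MetricSpace Y] {X : Type*} [MetricSpace X] (C : Set X) : Prop :=
  Nonempty (Y ≃ᵢ C)

/-- All points of `C` have the same colour. -/
def IsMonochromatic {X κ : Type*} (c : X → κ) (C : Set X) : Prop :=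
  ∀ x ∈ C, ∀ y ∈ C, c x = c y

/-- `X` can be coloured with `k` colours without a monochromatic copy of `Y`. -/
def ColorableAvoiding (X : Type*) [MetricSpace X] (Y : Type*) [MetricSpace Y] (k : ℕ) : Prop :=
  ∃ c : X → Fin k, ∀ C : Set X, IsCopy Y C → ¬ IsMonochromatic c C

/-- The chromatic number `χ(X, Y)`: the smallest `k` such that `X` can be coloured with `k` colours
without a monochromatic copy of `Y` (and `⊤` if no finite number of colours suffices). -/
noncomputable def chromaticNumberAvoiding (X : Type*) [MetricSpace X]
    (Y : Type*) [MetricSpace Y] : ℕ∞ :=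
  ⨅ (k : ℕ) (_ : ColorableAvoiding X Y k), (k : ℕ∞)

/-- `C ⊆ ℝⁿ` is a proper isometric copy of `geomBaton q` in the maximum metric (the metric of
`Fin n → ℝ`): it is an isometric copy and, for some `i`, the set of the `i`-th coordinates of its
points is a translate of `-geomBaton q`. -/
def IsProperCopy {n : ℕ} (q : ℝ) (C : Set (Fin n → ℝ)) : Prop :=
  IsCopy (geomBaton q) C ∧
    ∃ i : Fin n, ∃ t : ℝ, (fun x : Fin n → ℝ => x i) '' C = (fun g : ℝ => t - g) '' geomBaton q

/-- The cube `[-ε, 1 + ε]ⁿ`. -/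
def cube (n : ℕ) (ε : ℝ) : Set (Fin n → ℝ) :=
  {x | ∀ i, x i ∈ Set.Icc (-ε) (1 + ε)}

open Finset

/-! Lower bound: identify colours with coordinate directions and seek a tail, a sequence of colour
`i` descending in direction `i`. Induct on the directions (`exists_tail`): a face orthogonal to `i`
either has a point of colour `i` or, losing that colour and that direction, contains a tail by
induction. Descending greedily from a central point gives either a full tail or, when stuck, a tiny
tail of another colour; prepending points, or switching to tails in faces, raises the scale again
(`exists_tail_of_faces`).

Upper bound: some coordinate is parallel to the progression on a given finite part of a copy
(`exists_coord_eq`). A dilation `β` makes such a coordinate meet all residues of `⌊β t⌋` modulo `n +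
1` (`exists_dilation_close`), so colouring each point by a residue missed by its `n` coordinates
works. -/

/-! ### Monochromatic tails in boxes -/

/-- A sequence of points of colour `i` whose `i`-th coordinates decrease with steps
`r, r * q, r * q ^ 2, …` and whose consecutive distances in the other coordinates do not exceed
these steps. -/
def IsTail {ι : Type*} (c : (ι → ℝ) → ι) (i : ι) (r q : ℝ) (x : ℕ → ι → ℝ) : Prop :=
  ∀ j, c (x j) = i ∧ x (j + 1) i = x j i - r * q ^ j ∧ ∀ l, |x (j + 1) l - x j l| ≤ r * q ^ j

/-- The box with lower corner `a` and side `w` in the directions of `S`, degenerate in the other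
directions. -/
def sideBox {ι : Type*} (S : Finset ι) (a : ι → ℝ) (w : ℝ) : Set (ι → ℝ) :=
  {x | ∀ l, (l ∈ S → a l ≤ x l ∧ x l ≤ a l + w) ∧ (l ∉ S → x l = a l)}

/-- The cube with centre `p` and radius `ρ` in the directions of `S`, degenerate in the other
directions. -/
def sideBall {ι : Type*} (S : Finset ι) (p : ι → ℝ) (ρ : ℝ) : Set (ι → ℝ) :=
  {x | ∀ l, (l ∈ S → |x l - p l| ≤ ρ) ∧ (l ∉ S → x l = p l)}

theorem sideBall_mono {ι : Type*} {S : Finset ι} {p : ι → ℝ} {ρ ρ' : ℝ} (h : ρ ≤ ρ') :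
    sideBall S p ρ ⊆ sideBall S p ρ' :=
  fun _ hx l => ⟨fun hl => ((hx l).1 hl).trans h, (hx l).2⟩

theorem mem_sideBall_of_abs_sub_le {ι : Type*} {S : Finset ι} {p x y : ι → ℝ} {ρ δ : ℝ}
    (hx : x ∈ sideBall S p ρ) (hy : y ∈ sideBall S x δ) : y ∈ sideBall S p (ρ + δ) := by
  refine fun l => ⟨fun hl => ?_, fun hl => ((hy l).2 hl).trans ((hx l).2 hl)⟩
  have h := abs_sub_le (y l) (x l) (p l)
  linarith [(hx l).1 hl, (hy l).1 hl]

theorem exists_seq_of_step {α : Type*} (P : ℕ → α → Prop) (R : ℕ → α → α → Prop) (x₀ : α)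
    (h₀ : P 0 x₀) (h : ∀ k x, P k x → ∃ y, P (k + 1) y ∧ R k x y) :
    ∃ x : ℕ → α, x 0 = x₀ ∧ ∀ k, P k (x k) ∧ R k (x k) (x (k + 1)) := by
  choose! f hf using h
  let x : ℕ → α := fun k => Nat.rec x₀ f k
  have hP : ∀ k, P k (x k) := by
    intro k
    induction k with
    | zero => exact h₀
    | succ k ih => exact (hf k _ ih).1
  exact ⟨x, rfl, fun k => ⟨hP k, (hf k _ (hP k)).2⟩⟩

theorem IsTail.cons {ι : Type*} {c : (ι → ℝ) → ι} {i : ι} {r q : ℝ} {x : ℕ → ι → ℝ}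
    (hx : IsTail c i (r * q) q x) {y : ι → ℝ} (hc : c y = i) (hi : y i = x 0 i + r)
    (hl : ∀ l, |y l - x 0 l| ≤ r) :
    IsTail c i r q (fun k => Nat.casesOn k y x) := by
  rintro (_ | j)
  · refine ⟨hc, ?_, fun l => ?_⟩
    · simp [hi]
    · simpa [abs_sub_comm] using hl l
  · obtain ⟨h1, h2, h3⟩ := hx j
    have e : r * q ^ (j + 1) = r * q * q ^ j := by ring
    refine ⟨h1, ?_, fun l => ?_⟩
    · rw [e]; exact h2
    · rw [e]; exact h3 l

/-- The induction step of `exists_tail`; `IH` is the statement for the faces of the box. -/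
theorem exists_tail_of_faces {ι : Type*} [DecidableEq ι] {c : (ι → ℝ) → ι} {S : Finset ι}
    {ε q : ℝ} (hε : 0 < ε) (hε' : ε ≤ 1 / 2) (hq : 0 < q) (hq' : q ≤ ε / 4)
    (hq₂ : 2 ≤ #S → q ≤ ε / 8) {a : ι → ℝ} {r : ℝ} (hr : 0 < r)
    (hc : ∀ x ∈ sideBox S a ((1 + 2 * ε) * r), c x ∈ S)
    (IH : ∀ i ∈ S, ∀ (b : ι → ℝ) (ρ : ℝ), 0 < ρ →
      (∀ x ∈ sideBox (S.erase i) b ((1 + ε) * ρ), c x ∈ S.erase i) →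
      ∃ j ∈ S.erase i, ∃ x, IsTail c j ρ q x ∧ ∀ k, x k ∈ sideBox (S.erase i) b ((1 + ε) * ρ)) :
    ∃ i ∈ S, ∃ x, IsTail c i r q x ∧ ∀ k, x k ∈ sideBox S a ((1 + 2 * ε) * r) := by
  set B := sideBox S a ((1 + 2 * ε) * r) with hB
  have hq1 : q ≤ 1 / 8 := by linarith
  -- a face inside the box contains a point of the given colour or a tail of another colour
  have face : ∀ i ∈ S, ∀ (b : ι → ℝ) (ρ : ℝ), 0 < ρ →
      sideBox (S.erase i) b ((1 + ε) * ρ) ⊆ B →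
      (∃ y ∈ sideBox (S.erase i) b ((1 + ε) * ρ), c y = i) ∨
      ∃ j ∈ S.erase i, ∃ x, IsTail c j ρ q x ∧
        ∀ k, x k ∈ sideBox (S.erase i) b ((1 + ε) * ρ) := by
    intro i hi b ρ hρ hsub
    by_cases h : ∃ y ∈ sideBox (S.erase i) b ((1 + ε) * ρ), c y = i
    · exact .inl h
    · push Not at h
      exact .inr (IH i hi b ρ hρ fun x hx => mem_erase.2 ⟨h x hx, hc x (hsub hx)⟩)
  -- Used with `s = -ρ` to descend and `s = ρ` to prepend a point.
  have near : ∀ i ∈ S, ∀ (x : ι → ℝ) (ρ s : ℝ), 0 < ρ → |s| ≤ ρ → sideBall S x ρ ⊆ B →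
      (∃ y ∈ sideBall S x ρ, y i = x i + s ∧ c y = i) ∨
      ∃ j ∈ S, j ≠ i ∧ ∃ z, IsTail c j ρ q z ∧ ∀ k, z k ∈ sideBall S x ρ := by
    intro i hi x ρ s hρ hs hsub
    set b : ι → ℝ := fun l => if l = i then x i + s else if l ∈ S then x l - ρ else x l with hb
    have hbi : b i = x i + s := by simp [hb]
    have hsub' : ∀ y ∈ sideBox (S.erase i) b ((1 + ε) * ρ), y ∈ sideBall S x ρ ∧ y i = x i + s := by
      intro y hy
      have hyi : y i = x i + s := by rw [(hy i).2 (by simp), hbi]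
      refine ⟨fun l => ⟨fun hl => ?_, fun hl => ?_⟩, hyi⟩
      · by_cases hli : l = i
        · subst hli
          rw [hyi]; simpa using hs
        · have h := (hy l).1 (mem_erase.2 ⟨hli, hl⟩)
          simp only [hb, hli, hl, if_true, if_false] at h
          rw [abs_le]
          constructor <;> nlinarith
      · have hli : l ≠ i := fun h => hl (h ▸ hi)
        rw [(hy l).2 (fun h => hl (mem_of_mem_erase h))]
        simp [hb, hli, hl]
    rcases face i hi b ρ hρ (fun y hy => hsub (hsub' y hy).1) with ⟨y, hy, hcy⟩ | ⟨j, hj, z, hz, hzb⟩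
    · exact .inl ⟨y, (hsub' y hy).1, (hsub' y hy).2, hcy⟩
    · exact .inr ⟨j, mem_of_mem_erase hj, ne_of_mem_erase hj, z, hz, fun k => (hsub' _ (hzb k)).1⟩
  -- The ball of radius `ε / 2 * r` about `p` spans `[a l + ε * r, a l + 2 * ε * r]`: a face at
  -- height `r` above any of its points still fits in the box and, having side `(1 + ε) * r`, stays
  -- within distance `r` of that point.
  set p : ι → ℝ := fun l => if l ∈ S then a l + 3 / 2 * ε * r else a l with hp
  have hpS : ∀ l ∈ S, p l = a l + 3 / 2 * ε * r := fun l hl => by simp [hp, hl]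
  have hpS' : ∀ l ∉ S, p l = a l := fun l hl => by simp [hp, hl]
  have hεr : 0 < ε * r := mul_pos hε hr
  have ball : sideBall S p (ε / 2 * r) ⊆ B := by
    refine fun x hx l => ⟨fun hl => ?_, fun hl => ((hx l).2 hl).trans (hpS' l hl)⟩
    have h := abs_le.1 ((hx l).1 hl)
    rw [hpS l hl] at h
    constructor <;> nlinarith
  have hpow : ∀ k : ℕ, 0 < r * q ^ (k + 1) := fun k => by positivity
  have hpow' : ∀ k : ℕ, 8 * (r * q ^ (k + 2)) ≤ r * q ^ (k + 1) := by
    intro k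
    have e : r * q ^ (k + 2) = q * (r * q ^ (k + 1)) := by ring
    rw [e]
    nlinarith [hpow k]
  have hpow1 : ∀ k : ℕ, r * q ^ (k + 1) ≤ r * q := by
    intro k
    induction k with
    | zero => simp
    | succ k ih => linarith [hpow' k, hpow (k + 1)]
  have hqr : r * q ≤ ε * r / 4 := by nlinarith
  -- Descent and return together may drift by `4 * (r * q)`, which must be at most `ε / 2 * r`. With
  -- one direction there is no other colour to switch to, and the descent alone needs only `2 * (r *
  -- q)`.
  have hqr₂ : 2 ≤ #S → r * q ≤ ε * r / 8 := fun h => by nlinarith [hq₂ h]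
  -- it suffices to find a tail of the next scale near `p`
  suffices small : ∃ i ∈ S, ∃ x, IsTail c i (r * q) q x ∧ x 0 ∈ sideBall S p (ε / 2 * r) ∧
      ∀ k, x k ∈ B by
    obtain ⟨i, hi, x, hx, hx0, hxB⟩ := small
    have hx0S : ∀ l ∈ S, a l + ε * r ≤ x 0 l ∧ x 0 l ≤ a l + 2 * (ε * r) := by
      intro l hl
      have h := abs_le.1 ((hx0 l).1 hl)
      rw [hpS l hl] at h
      constructor <;> linarith
    have hx0S' : ∀ l ∉ S, x 0 l = a l := fun l hl => ((hx0 l).2 hl).trans (hpS' l hl)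
    set b : ι → ℝ := fun l => if l = i then x 0 i + r else a l with hb
    have hbi : b i = x 0 i + r := by simp [hb]
    have hbl : ∀ l, l ≠ i → b l = a l := fun l hl => by simp [hb, hl]
    have key : ∀ y ∈ sideBox (S.erase i) b ((1 + ε) * r),
        y ∈ B ∧ y i = x 0 i + r ∧ ∀ l, |y l - x 0 l| ≤ r := by
      intro y hy
      have hyi : y i = x 0 i + r := by rw [(hy i).2 (by simp), hbi]
      have hyS : ∀ l ∈ S, l ≠ i → a l ≤ y l ∧ y l ≤ a l + (1 + ε) * r := by
        intro l hl hli
        have h := (hy l).1 (mem_erase.2 ⟨hli, hl⟩)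
        rwa [hbl l hli] at h
      have hyS' : ∀ l ∉ S, y l = a l := by
        intro l hl
        have hli : l ≠ i := fun h => hl (h ▸ hi)
        rw [(hy l).2 (fun h => hl (mem_of_mem_erase h)), hbl l hli]
      refine ⟨fun l => ⟨fun hl => ?_, hyS' l⟩, hyi, fun l => ?_⟩
      · have h := hx0S l hl
        by_cases hli : l = i
        · subst hli
          rw [hyi]
          constructor <;> nlinarith
        · have h' := hyS l hl hli
          constructor <;> nlinarith
      · by_cases hli : l = i
        · subst hli
          rw [hyi]; simp [abs_of_pos hr]
        · by_cases hl : l ∈ S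
          · have h := hx0S l hl
            have h' := hyS l hl hli
            rw [abs_le]
            constructor <;> nlinarith
          · rw [hyS' l hl, hx0S' l hl]; simpa using hr.le
    rcases face i hi b r hr (fun y hy => (key y hy).1) with ⟨y, hy, hcy⟩ | ⟨j, hj, z, hz, hzb⟩
    · obtain ⟨h1, h2, h3⟩ := key y hy
      refine ⟨i, hi, _, hx.cons hcy h2 h3, ?_⟩
      rintro (_ | k)
      exacts [h1, hxB k]
    · exact ⟨j, mem_of_mem_erase hj, z, hz, fun k => (key _ (hzb k)).1⟩
  -- tails of small scale can be replaced by tails of larger scale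
  have back : 2 ≤ #S → ∀ k : ℕ, ∀ i ∈ S, ∀ x, IsTail c i (r * q ^ (k + 1)) q x →
      x 0 ∈ sideBall S p (2 * (r * q) + 2 * (r * q ^ (k + 1))) → (∀ k, x k ∈ B) →
      ∃ i ∈ S, ∃ x, IsTail c i (r * q) q x ∧ x 0 ∈ sideBall S p (ε / 2 * r) ∧ ∀ k, x k ∈ B := by
    intro hS k
    have hqr' := hqr₂ hS
    -- Raising the scale moves the start by at most `r * q ^ (k + 1)`, and `2 * q ^ (k + 2) + q ^ (k
    -- + 1) ≤ 2 * q ^ (k + 1)` keeps the radius bound.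
    induction k with
    | zero =>
      intro i hi x hx hx0 hxB
      rw [zero_add, pow_one] at hx hx0
      exact ⟨i, hi, x, hx, sideBall_mono (by linarith) hx0, hxB⟩
    | succ k ih =>
      intro i hi x hx hx0 hxB
      have hsub : sideBall S (x 0) (r * q ^ (k + 1)) ⊆
          sideBall S p (2 * (r * q) + 2 * (r * q ^ (k + 1))) := fun y hy =>
        sideBall_mono (by linarith [hpow' k, hpow k]) (mem_sideBall_of_abs_sub_le hx0 hy)
      have hsub' : sideBall S (x 0) (r * q ^ (k + 1)) ⊆ B := fun y hy =>
        ball (sideBall_mono (by linarith [hpow1 k]) (hsub hy))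
      rcases near i hi (x 0) _ (r * q ^ (k + 1)) (hpow k) (abs_of_pos (hpow k)).le hsub' with
        ⟨y, hy, hyi, hcy⟩ | ⟨j, hj, -, z, hz, hzb⟩
      · have e : r * q ^ (k + 1 + 1) = r * q ^ (k + 1) * q := by ring
        rw [e] at hx
        refine ih i hi _ (hx.cons hcy hyi fun l => ?_) (hsub hy) ?_
        · by_cases hl : l ∈ S
          · exact (hy l).1 hl
          · rw [(hy l).2 hl]; simpa using (hpow k).le
        · rintro (_ | m)
          exacts [hsub' hy, hxB m]
      · exact ih j hj z hz (hsub (hzb 0)) fun m => hsub' (hzb m)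
  have hpp : ∀ ρ, 0 ≤ ρ → p ∈ sideBall S p ρ := fun ρ hρ l => by simp [hρ]
  have hpc : c p ∈ S := hc p (ball (hpp _ (by positivity)))
  set i := c p with hi
  -- The radius dominates the total drift `r * q + ⋯ + r * q ^ k` of the first `k` steps.
  let P : ℕ → (ι → ℝ) → Prop := fun k x =>
    x ∈ sideBall S p (2 * (r * q) - 2 * (r * q ^ (k + 1))) ∧ c x = i
  let R : ℕ → (ι → ℝ) → (ι → ℝ) → Prop := fun k x y =>
    y i = x i - r * q ^ (k + 1) ∧ ∀ l, |y l - x l| ≤ r * q ^ (k + 1)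
  have hP0 : P 0 p := ⟨hpp _ (by simp), rfl⟩
  by_cases step : ∀ k x, P k x → ∃ y, P (k + 1) y ∧ R k x y
  · obtain ⟨x, hx0, hx⟩ := exists_seq_of_step P R p hP0 step
    refine ⟨i, hpc, x, fun j => ?_, hx0 ▸ hpp _ (by positivity), fun k => ?_⟩
    · have e : r * q * q ^ j = r * q ^ (j + 1) := by ring
      rw [e]
      exact ⟨(hx j).1.2, (hx j).2⟩
    · exact ball (sideBall_mono (by linarith [hpow k]) (hx k).1.1)
  · push Not at step
    obtain ⟨k, x, ⟨hxp, hxc⟩, hstuck⟩ := step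
    have hsub : sideBall S x (r * q ^ (k + 1)) ⊆
        sideBall S p (2 * (r * q) - r * q ^ (k + 1)) := fun y hy =>
      sideBall_mono (by linarith) (mem_sideBall_of_abs_sub_le hxp hy)
    have hsub' : sideBall S x (r * q ^ (k + 1)) ⊆ B := fun y hy =>
      ball (sideBall_mono (by linarith [hpow k]) (hsub hy))
    rcases near i hpc x _ (-(r * q ^ (k + 1))) (hpow k)
      (by rw [abs_neg, abs_of_pos (hpow k)]) hsub' with ⟨y, hy, hyi, hcy⟩ | ⟨j, hj, hji, z, hz, hzb⟩
    · refine absurd ⟨by linarith, fun l => ?_⟩ (hstuck y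
        ⟨sideBall_mono (by linarith [hpow' k, hpow (k + 1), hpow k]) (hsub hy), hcy⟩)
      by_cases hl : l ∈ S
      · exact (hy l).1 hl
      · rw [(hy l).2 hl]; simpa using (hpow k).le
    · have hS : 2 ≤ #S := one_lt_card.2 ⟨j, hj, i, hpc, hji⟩
      exact back hS k j hj z hz (sideBall_mono (by linarith [hpow k]) (hsub (hzb 0)))
        fun m => hsub' (hzb m)

/-- A box whose points have only colours from the set `S` of its nondegenerate directions contains
a tail. -/
theorem exists_tail {ι : Type*} [DecidableEq ι] (c : (ι → ℝ) → ι) {q : ℝ} (hq : 0 < q) (N : ℕ) :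
    ∀ S : Finset ι, #S = N → ∀ ε : ℝ, 0 < ε → ε ≤ 1 / 2 → q ≤ ε / 2 ^ (N + 1) →
      ∀ (a : ι → ℝ) (r : ℝ), 0 < r → (∀ x ∈ sideBox S a ((1 + 2 * ε) * r), c x ∈ S) →
      ∃ i ∈ S, ∃ x, IsTail c i r q x ∧ ∀ k, x k ∈ sideBox S a ((1 + 2 * ε) * r) := by
  induction N with
  | zero =>
    intro S hS ε _ _ _ a r _ hc
    obtain rfl := card_eq_zero.1 hS
    exact absurd (hc a fun l => ⟨by simp, fun _ => rfl⟩) (notMem_empty _)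
  | succ N ih =>
    intro S hS ε hε hε' hqε a r hr hc
    have h2 : ∀ m : ℕ, m ≤ N + 2 → q ≤ ε / 2 ^ m := fun m hm =>
      hqε.trans (div_le_div_of_nonneg_left hε.le (by positivity)
        (pow_le_pow_right₀ (by norm_num) hm))
    refine exists_tail_of_faces hε hε' hq ?_ (fun h => ?_) hr hc fun i hi b ρ hρ hb => ?_
    · convert h2 2 (by omega) using 2; norm_num
    · convert h2 3 (by omega) using 2; norm_num
    -- Faces have half the relative margin; each lost direction thus costs a factor `2` in the bound
    -- on `q`.
    · have e : (1 + ε) * ρ = (1 + 2 * (ε / 2)) * ρ := by ring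
      rw [e] at hb ⊢
      refine ih (S.erase i) (by rw [card_erase_of_mem hi, hS]; rfl) (ε / 2) (by linarith)
        (by linarith) ?_ b ρ hρ hb
      rw [div_div, ← pow_succ']
      exact hqε

/-! ### Copies of the geometric progression -/

/-- The points of the geometric progression. -/
noncomputable def geomPoint (q : ℝ) (k : ℕ) : ℝ := ∑ i ∈ range k, q ^ i

theorem geomBaton_eq_range (q : ℝ) : geomBaton q = Set.range (geomPoint q) := rfl

theorem geomPoint_succ (q : ℝ) (k : ℕ) : geomPoint q (k + 1) = geomPoint q k + q ^ k :=
  sum_range_succ _ _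

theorem geomPoint_zero (q : ℝ) : geomPoint q 0 = 0 := rfl

theorem geomPoint_strictMono {q : ℝ} (hq : 0 < q) : StrictMono (geomPoint q) :=
  strictMono_nat_of_lt_succ fun k => by
    rw [geomPoint_succ]; linarith [pow_pos hq k]

/-- The range of a sequence with the mutual distances of the geometric progression is a copy. -/
theorem isCopy_range {X : Type*} [MetricSpace X] {q : ℝ} (hq : 0 < q) {x : ℕ → X}
    (hx : ∀ j k, dist (x j) (x k) = dist (geomPoint q j) (geomPoint q k)) :
    IsCopy (geomBaton q) (Set.range x) := by
  have hg := (geomPoint_strictMono hq).injective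
  have hinj : Function.Injective x := fun j k h => hg (dist_eq_zero.1 (by rw [← hx, h, dist_self]))
  let e : geomBaton q ≃ Set.range x :=
    (Equiv.ofInjective _ hg).symm.trans (Equiv.ofInjective _ hinj)
  refine ⟨⟨e, Isometry.of_dist_eq ?_⟩⟩
  intro u v
  obtain ⟨j, rfl⟩ := (Equiv.ofInjective _ hg).surjective u
  obtain ⟨k, rfl⟩ := (Equiv.ofInjective _ hg).surjective v
  have he : ∀ k, e (Equiv.ofInjective _ hg k) = Equiv.ofInjective _ hinj k := fun k =>
    congrArg (Equiv.ofInjective x hinj) (Equiv.symm_apply_apply (Equiv.ofInjective _ hg) k)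
  change dist (e _) (e _) = _
  rw [he, he]
  exact hx j k

theorem IsTail.apply_eq {ι : Type*} {c : (ι → ℝ) → ι} {i : ι} {q : ℝ} {x : ℕ → ι → ℝ}
    (hx : IsTail c i 1 q x) (k : ℕ) : x k i = x 0 i - geomPoint q k := by
  induction k with
  | zero => simp [geomPoint_zero]
  | succ k ih => rw [(hx k).2.1, ih, geomPoint_succ]; ring

/-- The step bounds and the triangle inequality give `≤`; coordinate `i`, which moves by the full
step each time, gives `≥`. -/
theorem IsTail.dist_eq {ι : Type*} [Fintype ι] {c : (ι → ℝ) → ι} {i : ι} {q : ℝ} (hq : 0 < q)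
    {x : ℕ → ι → ℝ} (hx : IsTail c i 1 q x) (j k : ℕ) :
    dist (x j) (x k) = dist (geomPoint q j) (geomPoint q k) := by
  wlog hjk : j ≤ k generalizing j k
  · rw [dist_comm, this k j (by omega), dist_comm]
  have hmono := (geomPoint_strictMono hq).monotone hjk
  have hd : dist (geomPoint q j) (geomPoint q k) = geomPoint q k - geomPoint q j := by
    rw [dist_comm, Real.dist_eq, abs_of_nonneg (by linarith)]
  refine le_antisymm ?_ ?_
  · rw [hd]
    clear hd hmono
    induction k, hjk using Nat.le_induction with
    | base => simp
    | succ k hjk ih =>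
      have h : dist (x k) (x (k + 1)) ≤ q ^ k := by
        rw [dist_comm]
        refine (dist_pi_le_iff (by positivity)).2 fun l => ?_
        simpa [Real.dist_eq] using (hx k).2.2 l
      rw [geomPoint_succ]
      linarith [dist_triangle (x j) (x k) (x (k + 1))]
  · refine le_trans (le_of_eq ?_) (dist_le_pi_dist (x j) (x k) i)
    rw [hx.apply_eq j, hx.apply_eq k, dist_sub_left]

theorem IsTail.isProperCopy {n : ℕ} {c : (Fin n → ℝ) → Fin n} {i : Fin n} {q : ℝ} (hq : 0 < q)
    {x : ℕ → Fin n → ℝ} (hx : IsTail c i 1 q x) : IsProperCopy q (Set.range x) := by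
  refine ⟨isCopy_range hq (hx.dist_eq hq), i, x 0 i, ?_⟩
  rw [geomBaton_eq_range, ← Set.range_comp, ← Set.range_comp]
  exact congrArg Set.range (funext hx.apply_eq)

theorem exists_monochromatic_properCopy (n : ℕ) {ε : ℝ} (hε : 0 < ε) (hε' : ε ≤ 1 / 2) {q : ℝ}
    (hq : 0 < q) (hqε : q ≤ ε / 2 ^ (n + 1)) (c : cube n ε → Fin n) :
    ∃ C : Set (cube n ε),
      IsMonochromatic c C ∧ IsProperCopy q ((fun x : cube n ε => (x : Fin n → ℝ)) '' C) := by
  classical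
  have h0 : (fun _ => 0 : Fin n → ℝ) ∈ cube n ε := fun i => ⟨by linarith, by linarith⟩
  let c' : (Fin n → ℝ) → Fin n := fun x => if h : x ∈ cube n ε then c ⟨x, h⟩ else c ⟨_, h0⟩
  obtain ⟨i, -, x, hx, hxB⟩ := exists_tail c' hq n univ (by simp) ε hε hε' hqε (fun _ => -ε) 1
    one_pos (fun _ _ => mem_univ _)
  have hxC : ∀ k, x k ∈ cube n ε := fun k l => by
    have h := (hxB k l).1 (mem_univ l)
    exact ⟨h.1, by linarith [h.2]⟩
  have hc : ∀ k, c ⟨x k, hxC k⟩ = i := fun k => by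
    have h := (hx k).1
    simpa only [c', hxC k, dite_true] using h
  refine ⟨Set.range fun k => ⟨x k, hxC k⟩, ?_, ?_⟩
  · rintro _ ⟨j, rfl⟩ _ ⟨k, rfl⟩
    rw [hc, hc]
  · rw [← Set.range_comp]
    exact hx.isProperCopy hq

/-! ### Colouring with one more colour than the dimension -/

/-- In the maximum metric a finite part of a copy of the geometric progression is parallel to the
progression in some coordinate. -/
theorem exists_coord_eq {n : ℕ} {q : ℝ} (hq : 0 < q) {x : ℕ → Fin n → ℝ}
    (hx : ∀ j k, dist (x j) (x k) = dist (geomPoint q j) (geomPoint q k)) {K : ℕ} (hK : 0 < K) :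
    ∃ i, ∃ σ : ℝ, (σ = 1 ∨ σ = -1) ∧ ∀ k ≤ K, x k i = x 0 i + σ * geomPoint q k := by
  have hmono := geomPoint_strictMono hq
  have hd : ∀ j k, j ≤ k → dist (x j) (x k) = geomPoint q k - geomPoint q j := fun j k hjk => by
    rw [hx, dist_comm, Real.dist_eq, abs_of_nonneg (sub_nonneg.2 (hmono.monotone hjk))]
  have hKpos : 0 < geomPoint q K := by simpa [geomPoint_zero] using hmono hK
  -- A coordinate realising the distance from `x 0` to `x K` leaves no slack in the triangle
  -- inequality at any intermediate point.
  have hex : ∃ i, geomPoint q K ≤ dist (x 0 i) (x K i) := by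
    by_contra! h
    have := (dist_pi_lt_iff hKpos).2 h
    rw [hd 0 K (Nat.zero_le _), geomPoint_zero, sub_zero] at this
    exact lt_irrefl _ this
  obtain ⟨i, hi⟩ := hex
  have h1 : ∀ k, |x 0 i - x k i| ≤ geomPoint q k := fun k => by
    simpa [hd 0 k (Nat.zero_le _), geomPoint_zero, Real.dist_eq] using
      dist_le_pi_dist (x 0) (x k) i
  have h2 : ∀ k ≤ K, |x k i - x K i| ≤ geomPoint q K - geomPoint q k := fun k hk => by
    simpa [hd k K hk, Real.dist_eq] using dist_le_pi_dist (x k) (x K) i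
  rw [Real.dist_eq] at hi
  rcases le_abs.1 hi with h | h
  · refine ⟨i, -1, .inr rfl, fun k hk => ?_⟩
    have := abs_le.1 (h1 k)
    have := abs_le.1 (h2 k hk)
    linarith
  · refine ⟨i, 1, .inl rfl, fun k hk => ?_⟩
    have := abs_le.1 (h1 k)
    have := abs_le.1 (h2 k hk)
    linarith

/-- The first `K` powers of `q` can be dilated into `M ℤ + [1/4, 1/2]` simultaneously. -/
theorem exists_dilation {M q : ℝ} (hM : 1 ≤ M) (hq : 0 < q) (hqM : q ≤ 1 / (8 * M)) (K : ℕ) :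
    ∃ u : ℝ, ∀ β, u ≤ β → β ≤ u + 1 / 4 → ∀ k < K, ∃ z : ℤ,
      1 / 4 ≤ β * q ^ k - M * z ∧ β * q ^ k - M * z ≤ 1 / 2 := by
  induction K with
  | zero => exact ⟨0, by simp⟩
  | succ K ih =>
    obtain ⟨u, hu⟩ := ih
    have hM0 : 0 < M := by linarith
    have hqM' : q * (8 * M) ≤ 1 := (le_div_iff₀ (by positivity)).1 hqM
    -- Carrying an interval of admissible `β` drives the induction: `q * M * z` is the first
    -- multiple of `q * M` from `u` on, and `q * M ≤ 1 / 8` keeps `β * q` in the old interval.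
    set z : ℤ := ⌈u / (q * M)⌉ with hz
    have hz1 : u ≤ z * (q * M) := (div_le_iff₀ (by positivity)).1 (Int.le_ceil _)
    have hz2 : (z - 1) * (q * M) ≤ u := by
      have := Int.ceil_lt_add_one (u / (q * M))
      rw [← hz] at this
      exact (le_div_iff₀ (by positivity)).1 (by linarith)
    refine ⟨M * z + 1 / 4, fun β hβ hβ' k hk => ?_⟩
    rcases k with _ | k
    · exact ⟨z, by simp only [pow_zero]; constructor <;> linarith⟩
    · have e : β * q ^ (k + 1) = β * q * q ^ k := by ring
      rw [e]
      refine hu (β * q) ?_ ?_ k (by omega)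
      · nlinarith
      · nlinarith

/-- A sequence with steps in `[1/4, 1/2]` approaches every value within its reach. -/
theorem exists_mem_Ico_of_steps {V : ℕ → ℝ} {K : ℕ}
    (hV : ∀ k < K, 1 / 4 ≤ V (k + 1) - V k ∧ V (k + 1) - V k ≤ 1 / 2) {T : ℝ} (h0 : V 0 < T)
    (hK : T ≤ V 0 + K / 4) : ∃ k ≤ K, T ≤ V k ∧ V k < T + 1 / 2 := by
  have hlow : ∀ k ≤ K, V 0 + k / 4 ≤ V k := by
    intro k
    induction k with
    | zero => simp
    | succ k ih =>
      intro hk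
      have := ih (by omega)
      have := (hV k (by omega)).1
      push_cast
      linarith
  have hex : ∃ k, T ≤ V k := ⟨K, hK.trans (hlow K le_rfl)⟩
  classical
  have hle : Nat.find hex ≤ K := Nat.find_min' hex (hK.trans (hlow K le_rfl))
  refine ⟨Nat.find hex, hle, Nat.find_spec hex, ?_⟩
  rcases hk : Nat.find hex with _ | k
  · linarith
  · have h1 := Nat.find_min hex (m := k) (by omega)
    have h2 := (hV k (by omega)).2
    linarith

/-- A dilation of the beginning of the geometric progression that comes close to every residue
class modulo `m`. -/
theorem exists_dilation_close {m : ℕ} (hm : 1 ≤ m) {q : ℝ} (hq : 0 < q)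
    (hqm : q ≤ 1 / (8 * (m : ℝ))) :
    ∃ β : ℝ, ∀ τ : ℝ, ∃ k ≤ 4 * m, ∃ z : ℤ, |β * geomPoint q k - m * z - τ| < 1 / 2 := by
  have hm' : (1 : ℝ) ≤ m := by exact_mod_cast hm
  obtain ⟨β, hβ⟩ := exists_dilation hm' hq hqm (4 * m)
  specialize hβ β le_rfl (by linarith)
  choose! w hw using hβ
  set V : ℕ → ℝ := fun k => ∑ i ∈ range k, (β * q ^ i - m * w i) with hVdef
  have hVβ : ∀ k, β * geomPoint q k = V k + m * ((∑ i ∈ range k, w i : ℤ) : ℝ) := fun k => by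
    simp only [hVdef, geomPoint, sum_sub_distrib, ← mul_sum]
    push_cast
    ring
  have hV : ∀ k < 4 * m, 1 / 4 ≤ V (k + 1) - V k ∧ V (k + 1) - V k ≤ 1 / 2 := fun k hk => by
    have : V (k + 1) - V k = β * q ^ k - m * w k := by
      simp only [hVdef, sum_range_succ]
      ring
    rw [this]
    exact hw k hk
  refine ⟨β, fun τ => ?_⟩
  have hm0 : (0 : ℝ) < m := by linarith
  have hf1 : (⌊-τ / m⌋ : ℝ) * m ≤ -τ := (le_div_iff₀ hm0).1 (Int.floor_le _)
  have hf2 : -τ < (⌊-τ / m⌋ + 1 : ℝ) * m := (div_lt_iff₀ hm0).1 (Int.lt_floor_add_one _)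
  have hV0 : V 0 = 0 := by simp [hVdef]
  -- This `T` is the representative of `τ` modulo `m` in `(0, m]`, within reach of `4 * m` steps of
  -- at least `1 / 4`.
  obtain ⟨k, hk, h1, h2⟩ := exists_mem_Ico_of_steps hV (T := τ + m * (⌊-τ / m⌋ + 1))
    (by rw [hV0]; linarith) (by rw [hV0]; push_cast; linarith)
  refine ⟨k, hk, (∑ i ∈ range k, w i) + (⌊-τ / m⌋ + 1), ?_⟩
  rw [hVβ, abs_lt]
  push_cast at *
  constructor <;> linarith

theorem colorableAvoiding_succ (n : ℕ) {q : ℝ} (hq : 0 < q) (hqn : q ≤ 1 / (8 * ((n + 1 : ℕ) : ℝ))) :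
    ColorableAvoiding (Fin n → ℝ) (geomBaton q) (n + 1) := by
  obtain ⟨β, hβ⟩ := exists_dilation_close (Nat.succ_pos n) hq hqn
  let f : ℝ → ZMod (n + 1) := fun t => (⌊β * t⌋ : ℤ)
  have hf : ∀ x : Fin n → ℝ, ∃ j : Fin (n + 1), ∀ i, f (x i) ≠ (j : ℕ) := by
    intro x
    by_contra! h
    choose g hg using h
    have hinj : Function.Injective g := fun j j' hjj => by
      have h1 : ((j : ℕ) : ZMod (n + 1)) = (j' : ℕ) := by rw [← hg j, ← hg j', hjj]
      have h2 := (ZMod.natCast_eq_natCast_iff' _ _ _).1 h1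
      rw [Nat.mod_eq_of_lt j.2, Nat.mod_eq_of_lt j'.2] at h2
      exact Fin.ext h2
    simpa using Fintype.card_le_of_injective g hinj
  choose c hc using hf
  refine ⟨c, fun C ⟨e⟩ hmono => ?_⟩
  let x : ℕ → Fin n → ℝ := fun k => e ⟨geomPoint q k, k, rfl⟩
  have hxC : ∀ k, x k ∈ C := fun k => (e ⟨geomPoint q k, k, rfl⟩).2
  have hx : ∀ j k, dist (x j) (x k) = dist (geomPoint q j) (geomPoint q k) := fun j k =>
    e.isometry.dist_eq ⟨geomPoint q j, j, rfl⟩ ⟨geomPoint q k, k, rfl⟩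
  obtain ⟨i, σ, hσ, hxi⟩ := exists_coord_eq hq hx (K := 4 * (n + 1)) (by omega)
  set j := c (x 0) with hj
  -- The target is the midpoint of the unit interval with floor `j`; `σ` accounts for a reversed
  -- direction.
  obtain ⟨k, hk, z, hz⟩ := hβ (σ * ((j : ℕ) + 1 / 2 - β * x 0 i))
  have hclose : ∃ w : ℤ, |β * x k i - ((n + 1 : ℕ) : ℝ) * w - ((j : ℕ) + 1 / 2)| < 1 / 2 := by
    rw [hxi k hk]
    rcases hσ with rfl | rfl
    · refine ⟨z, ?_⟩
      convert hz using 2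
      ring
    · refine ⟨-z, ?_⟩
      rw [← abs_neg] at hz
      convert hz using 2
      push_cast
      ring
  obtain ⟨w, hw⟩ := hclose
  rw [abs_lt] at hw
  have hfloor : ⌊β * x k i⌋ = ((n + 1 : ℕ) : ℤ) * w + (j : ℕ) := by
    rw [Int.floor_eq_iff]
    push_cast at *
    constructor <;> linarith
  refine hc (x k) i ?_
  rw [← hmono _ (hxC 0) _ (hxC k), ← hj]
  simp only [f, hfloor]
  rw [Int.cast_add, Int.cast_mul, Int.cast_natCast, Int.cast_natCast, ZMod.natCast_self, zero_mul,
    zero_add]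

/-- Fewer colours embed into `Fin n`, so the cube statement with `ε = 1 / 2` applies. -/
theorem not_colorableAvoiding_of_le {n k : ℕ} (hk : k ≤ n) {q : ℝ} (hq : 0 < q)
    (hqn : q ≤ 1 / 2 / 2 ^ (n + 1)) : ¬ ColorableAvoiding (Fin n → ℝ) (geomBaton q) k := by
  rintro ⟨c, hc⟩
  obtain ⟨C, hC, hcopy, -⟩ := exists_monochromatic_properCopy n (ε := 1 / 2) (by norm_num) le_rfl hq
    hqn fun x => Fin.castLE hk (c x)
  refine hc _ hcopy ?_
  rintro _ ⟨x, hx, rfl⟩ _ ⟨y, hy, rfl⟩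
  exact Fin.castLE_injective hk (hC x hx y hy)

theorem theorem6 :
    (∀ (n : ℕ) (ε : ℝ), 0 < ε → ε ≤ 1 / 2 →
      ∀ q : ℝ, 0 < q → q ≤ ε / 2 ^ (n + 1) →
        ∀ c : cube n ε → Fin n,
          ∃ C : Set (cube n ε),
            IsMonochromatic c C ∧ IsProperCopy q ((fun x : cube n ε => (x : Fin n → ℝ)) '' C)) ∧
    (∀ n : ℕ, ∃ q₀ : ℝ, 0 < q₀ ∧ ∀ q : ℝ, 0 < q → q ≤ q₀ →
      chromaticNumberAvoiding (Fin n → ℝ) (geomBaton q) = (n : ℕ∞) + 1) := by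
  refine ⟨fun n ε hε hε' q hq hqε c => exists_monochromatic_properCopy n hε hε' hq hqε c,
    fun n => ⟨min (1 / 2 / 2 ^ (n + 1)) (1 / (8 * ((n + 1 : ℕ) : ℝ))),
      lt_min (by positivity) (by positivity), fun q hq hq₀ => ?_⟩⟩
  refine le_antisymm ?_ (le_iInf₂ fun k hk => ?_)
  · exact iInf₂_le_of_le (n + 1) (colorableAvoiding_succ n hq (hq₀.trans (min_le_right _ _)))
      (by push_cast; rfl)
  · have h : n + 1 ≤ k := by
      by_contra h
      exact not_colorableAvoiding_of_le (by omega) hq (hq₀.trans (min_le_left _ _)) hk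
    exact_mod_cast h
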